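/- **Model.** Let $\bar\gamma,\mu,m>0$ and $\kappa\ge 0$. The $\kappa$-$\mu$ shadowed distribution $\mathcal S_{\kappa\mu}(\bar\gamma;\kappa,\mu,m)$ is the law on $(0,\infty)$ with density $$f(x)=\int_0^\infty f(x\mid\xi)\,\frac{2m^m}{\Gamma(m)}\,\xi^{2m-1}e^{-m\xi^2}\,d\xi ,$$ that is, a conditional $\kappa$-$\mu$ density averaged over a Nakagami-$m$ amplitude $\xi$ with $\mathbb E[\xi^2]=1$, where for $\kappa>0$ $$f(x\mid\xi)=\frac{\mu(1+\kappa)^{\frac{\mu+1}{2}}}{\bar\gamma\,\kappa^{\frac{\mu-1}{2}}e^{\xi^2\mu\kappa}}\Bigl(\frac{x}{\xi^2\bar\gamma}\Bigr)^{\frac{\mu-1}{2}}e^{-\frac{\mu(1+\kappa)x}{\bar\gamma}}\,I_{\mu-1}\Bigl(2\mu\xi\sqrt{\tfrac{\kappa(1+\kappa)x}{\bar\gamma}}\Bigr),$$ with $I_\nu$ the modified Bessel function of the first kind, and for $\kappa=0$ its limit $f(x\mid\xi)=\frac{(\mu/\bar\gamma)^\mu}{\Gamma(\mu)}x^{\mu-1}e^{-\mu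 x/\bar\gamma}$. The Lauricella function $F_D^{(N)}(a,b_1,\dots,b_N;c;x_1,\dots,x_N)$ is the holomorphic function on $(\mathbb C\setminus[1,\infty))^N$ which on the polydisc $\max_i|x_i|<1$ is the sum of the absolutely convergent series $$\sum_{k_1,\dots,k_N\ge 0}\frac{(a)_{k_1+\cdots+k_N}\,(b_1)_{k_1}\cdots(b_N)_{k_N}}{(c)_{k_1+\cdots+k_N}}\,\frac{x_1^{k_1}\cdots x_N^{k_N}}{k_1!\cdots k_N!},$$ with $(a)_n=a(a+1)\cdots(a+n-1)$. Let $Q(x)=\frac1{\sqrt{2\pi}}\int_x^\infty e^{-t^2/2}\,dt$. **Statement.** Let $\gamma_1,\dots,\gamma_L$ be mutually independent random variables with $\gamma_k\sim\mathcal S_{\kappa\mu}(\bar\gamma_k;\kappa_k,\mu_k,m_k)$, where $\bar\gamma_k,\mu_k,m_k>0$ and $\kappa_k\ge0$, and let $\gamma=\sum_{k=1}^L\gamma_k$ be the SNR after $L$-branch maximal ratio combining. Let $\alpha_1,\dots,\alpha_R\in\mathbb R$ and $\beta_1,\dots,\beta_R>0$. Put $M=\sum_{k=1}^L\mu_k$.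 Then the function $F_D^{(2L)}$ with parameters $a=\frac12+M$, $(b_i)=(\mu_1-m_1,\dots,\mu_L-m_L,m_1,\dots,m_L)$, $c=1+M$ exists, and the average bit error probability $P_b=\sum_{r=1}^R\alpha_r\,\mathbb E\bigl[Q(\sqrt{\beta_r\gamma})\bigr]$ equals $$P_b=\left(\frac{\Gamma(\frac12+M)}{\Gamma(1+M)}\prod_{k=1}^L\frac{\mu_k^{\mu_k}m_k^{m_k}(1+\kappa_k)^{\mu_k}}{(\mu_k\kappa_k+m_k)^{m_k}}\Bigl(\frac1{\bar\gamma_k}\Bigr)^{\mu_k}\right)\sum_{r=1}^R\frac{\alpha_r\sqrt{\beta_r}}{\sqrt{8\pi}}\Bigl(\frac2{\beta_r}\Bigr)^{\frac12+M}$$ $$\times\,F_D^{(2L)}\Bigl(\tfrac12+M,\ \mu_1-m_1,\dots,\mu_L-m_L,\ m_1,\dots,m_L;\ 1+M;\ x_{1,r},\dots,x_{L,r},\ y_{1,r},\dots,y_{L,r}\Bigr),$$ where $x_{k,r}=-\dfrac{2\mu_k(1+\kappa_k)}{\bar\gamma_k\beta_r}$ and $y_{k,r}=x_{k,r}\,\dfrac{m_k}{\mu_k\kappa_k+m_k}$.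 -/

import Mathlib

open MeasureTheory ProbabilityTheory

noncomputable section

/-- The modified Bessel function of the first kind `I_ν(x)`, real order, by its power series. -/
def besselI (ν x : ℝ) : ℝ :=
  ∑' k : ℕ, (x / 2) ^ (2 * (k : ℝ) + ν) / ((k.factorial : ℝ) * Real.Gamma ((k : ℝ) + ν + 1))

/-- The density of a Nakagami-`m` random amplitude `ξ` with `E[ξ²] = 1`, at a point `ξ > 0`. -/
def nakagamiPDF (m ξ : ℝ) : ℝ :=
  2 * m ^ m / Real.Gamma m * ξ ^ (2 * m - 1) * Real.exp (-(m * ξ ^ 2))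

/-- The conditional density, at a point `x > 0`, of the instantaneous SNR given the shadowing
amplitude `ξ > 0`: the `κ`-`μ` density with dominant components scaled by `ξ`.  For `κ = 0`
(no dominant component) the general formula reads `0 / 0`; its limit as `κ → 0` is the Gamma
density with shape `μ` and rate `μ / gbar`. -/
def kappaMuCondPDF (gbar κ μ ξ x : ℝ) : ℝ :=
  if κ = 0 then gammaPDFReal μ (μ / gbar) x
  else
    μ * (1 + κ) ^ ((μ + 1) / 2) /
        (gbar * κ ^ ((μ - 1) / 2) * Real.exp (ξ ^ 2 * μ * κ)) *
      (x / (ξ ^ 2 * gbar)) ^ ((μ - 1) / 2) *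
      Real.exp (-(μ * (1 + κ) * x / gbar)) *
      besselI (μ - 1) (2 * μ * ξ * Real.sqrt (κ * (1 + κ) * x / gbar))

/-- The `κ`-`μ` shadowed distribution `S_{κμ}(gbar; κ, μ, m)` of the instantaneous SNR: the law on
`(0, ∞)` whose density is the conditional `κ`-`μ` density averaged over the Nakagami-`m`
shadowing amplitude. -/
def kappaMuShadowed (gbar κ μ m : ℝ) : Measure ℝ :=
  (volume.restrict (Set.Ioi 0)).withDensity fun x =>
    ∫⁻ ξ in Set.Ioi (0 : ℝ), ENNReal.ofReal (kappaMuCondPDF gbar κ μ ξ x * nakagamiPDF m ξ)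

/-- The Gaussian tail function `Q`. -/
def gaussianQ (x : ℝ) : ℝ :=
  1 / Real.sqrt (2 * Real.pi) * ∫ t in Set.Ioi x, Real.exp (-(t ^ 2) / 2)

/-- The Pochhammer symbol `(a)_n = a (a + 1) ⋯ (a + n - 1)`. -/
def pochhammerC (a : ℂ) (n : ℕ) : ℂ := (ascPochhammer ℂ n).eval a

/-- The term of multi-index `k` of the Lauricella series `F_D`. -/
def lauricellaFDTerm {ι : Type*} [Fintype ι] (a : ℂ) (b : ι → ℂ) (c : ℂ) (x : ι → ℂ)
    (k : ι → ℕ) : ℂ :=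
  pochhammerC a (∑ i, k i) * (∏ i, pochhammerC (b i) (k i)) / pochhammerC c (∑ i, k i) *
    ∏ i, x i ^ k i / ((k i).factorial : ℂ)

/-- The domain of the principal branch of `F_D`: no coordinate lies on the cut `[1, ∞)`. -/
def lauricellaFDDomain (ι : Type*) : Set (ι → ℂ) :=
  {x | ∀ i, 1 - x i ∈ Complex.slitPlane}

/-- `F` is the Lauricella function `F_D` with parameters `a; b; c`: on the open unit polydisc it is
the sum of the (absolutely convergent) Lauricella series, and it is holomorphic on the product of
the cut planes `ℂ \ [1, ∞)`. -/
structure IsLauricellaFD {ι : Type*} [Fintype ι] (a : ℂ) (b : ι → ℂ) (c : ℂ)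
    (F : (ι → ℂ) → ℂ) : Prop where
  hasSum : ∀ x : ι → ℂ, (∀ i, ‖x i‖ < 1) → HasSum (lauricellaFDTerm a b c x) (F x)
  holomorphic : DifferentiableOn ℂ F (lauricellaFDDomain ι)

/-- The multivariate Lauricella function `F_D(a; b; c; x)`: the analytic continuation of the
Lauricella series. -/
def lauricellaFD {ι : Type*} [Fintype ι] (a : ℂ) (b : ι → ℂ) (c : ℂ) : (ι → ℂ) → ℂ :=
  Classical.epsilon (IsLauricellaFD a b c)

/-- The continuation is unique on the domain of the principal branch. -/
theorem IsLauricellaFD.eqOn {ι : Type*} [Fintype ι] {a : ℂ} {b : ι → ℂ} {c : ℂ}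
    {F G : (ι → ℂ) → ℂ} (hF : IsLauricellaFD a b c F) (hG : IsLauricellaFD a b c G) :
    Set.EqOn F G (lauricellaFDDomain ι) := by
  intro x hx
  set V : Set ℂ := {z | ∀ i, 1 - z * x i ∈ Complex.slitPlane} with hV
  have hVo : IsOpen V := by
    rw [hV, Set.ofPred_forall]
    refine isOpen_iInter_of_finite fun i => ?_
    exact Complex.isOpen_slitPlane.preimage (by fun_prop : Continuous fun z : ℂ => 1 - z * x i)
  have h0 : (0 : ℂ) ∈ V := fun i => by simp
  have hstar : StarConvex ℝ (0 : ℂ) V := by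
    intro z hz s t hs ht hst i
    have := Complex.starConvex_one_slitPlane (hz i) hs ht hst
    convert this using 1
    simp only [Complex.real_smul, smul_zero, zero_add]
    have : (s : ℂ) + t = 1 := by exact_mod_cast hst
    linear_combination (-1 : ℂ) * this
  have hVc : IsPreconnected V := (hstar.isPathConnected h0).isConnected.isPreconnected
  have hmaps : Set.MapsTo (fun z : ℂ => z • x) V (lauricellaFDDomain ι) := fun z hz i => hz i
  have hd : DifferentiableOn ℂ (fun z : ℂ => F (z • x) - G (z • x)) V := by
    have hl : DifferentiableOn ℂ (fun z : ℂ => z • x) V := by fun_prop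
    exact (hF.holomorphic.comp hl hmaps).sub (hG.holomorphic.comp hl hmaps)
  have hz : (fun z : ℂ => F (z • x) - G (z • x)) =ᶠ[nhds 0] 0 := by
    have hc : Continuous fun z : ℂ => z • x := by fun_prop
    have hs : ∀ᶠ z in nhds (0 : ℂ), ∀ i, ‖(z • x) i‖ < 1 := by
      rw [Filter.eventually_all]
      intro i
      have hci : Continuous fun z : ℂ => ‖(z • x) i‖ := by fun_prop
      exact hci.continuousAt.eventually (gt_mem_nhds (by simp))
    filter_upwards [hs] with z hz
    simp [(hF.hasSum _ hz).unique (hG.hasSum _ hz)]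
  have := (hd.analyticOnNhd hVo).eqOn_zero_of_preconnected_of_eventuallyEq_zero hVc h0 hz
    (show (1 : ℂ) ∈ V from fun i => by simpa using hx i)
  simpa [sub_eq_zero] using this

end

noncomputable section

/-! Craig's formula (`gaussianQ_sqrt`) writes Q(√v) as half the mean of exp(-v/(2u)) under the
Beta(1/2, 1/2) law of u. Fubini then turns E[Q(√(βγ))] into half the Beta average of the moment
generating function of γ at -β/(2u), which factors over the branches by independence.

For one branch, expanding the Bessel function shows that the conditional law is a Poisson(ξ²μκ)
mixture of Gamma(μ + k) laws of rate a = μ(1+κ)/γ̄. With ρ = a/(a+s), its Laplace transform is ρ^μ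
exp(-ξ²μκ(1-ρ)), and the Nakagami average makes it ρ^μ (m/(m+μκ(1-ρ)))^m. At s = β/(2u) this is a
constant times u^μ (1-xu)^(m-μ) (1-yu)^(-m), with x and y the Lauricella arguments
(`mgf_kappaMuShadowed_eq_mul`).

The product of the factors u^(μ_k) is u^M, which turns Beta(1/2, 1/2) into Beta(1/2+M, 1/2) up to
normalisation. What remains is Euler's integral for F_D with a = 1/2+M and c - a = 1/2. That
integral sums the series on the polydisc and is holomorphic on the cut domain
(`isLauricellaFD_lauricellaEuler`). So F_D exists, and by uniqueness of the continuation it equals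
the integral even at arguments outside the polydisc. -/

/-! ### Products of absolutely convergent series -/

/-- Induction step on the number of factors: one more series is multiplied in. Summability of the
norms travels with the sum because multiplying two series needs it. -/
theorem hasSum_prod_pi_option {α : Type*} [Fintype α] (f : Option α → ℕ → ℂ)
    (hf : ∀ i, Summable fun n => ‖f i n‖)
    (h1 : Summable fun k : α → ℕ => ‖∏ i, f (some i) (k i)‖)
    (h2 : HasSum (fun k : α → ℕ => ∏ i, f (some i) (k i)) (∏ i, ∑' n, f (some i) n)) :
    (Summable fun k : Option α → ℕ => ‖∏ i, f i (k i)‖) ∧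
      HasSum (fun k : Option α → ℕ => ∏ i, f i (k i)) (∏ i, ∑' n, f i n) := by
  have hs := (hf none).mul_norm h1
  constructor
  · rw [← (Equiv.piOptionEquivProd (β := fun _ : Option α => ℕ)).symm.summable_iff]
    simpa [Function.comp_def, Fintype.prod_option] using hs
  · rw [← (Equiv.piOptionEquivProd (β := fun _ : Option α => ℕ)).symm.hasSum_iff,
      Fintype.prod_option]
    have := (hf none).of_norm.hasSum.mul h2 hs.of_norm
    simpa [Function.comp_def, Fintype.prod_option] using this

theorem hasSum_prod_pi_equiv {α β : Type*} [Fintype α] [Fintype β] (e : α ≃ β) (f : β → ℕ → ℂ)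
    (h1 : Summable fun k : α → ℕ => ‖∏ i, f (e i) (k i)‖)
    (h2 : HasSum (fun k : α → ℕ => ∏ i, f (e i) (k i)) (∏ i, ∑' n, f (e i) n)) :
    (Summable fun k : β → ℕ => ‖∏ i, f i (k i)‖) ∧
      HasSum (fun k : β → ℕ => ∏ i, f i (k i)) (∏ i, ∑' n, f i n) := by
  have hk (k : α → ℕ) : ∏ b, f b ((e.arrowCongr (Equiv.refl ℕ)) k b) = ∏ a, f (e a) (k a) := by
    rw [← e.prod_comp]
    simp
  constructor
  · rw [← (e.arrowCongr (Equiv.refl ℕ)).summable_iff]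
    simpa only [Function.comp_def, hk] using h1
  · rw [← (e.arrowCongr (Equiv.refl ℕ)).hasSum_iff, ← e.prod_comp]
    simpa only [Function.comp_def, hk] using h2

theorem hasSum_prod_pi_fin (n : ℕ) (f : Fin n → ℕ → ℂ) (hf : ∀ i, Summable fun n => ‖f i n‖) :
    (Summable fun k : Fin n → ℕ => ‖∏ i, f i (k i)‖) ∧
      HasSum (fun k : Fin n → ℕ => ∏ i, f i (k i)) (∏ i, ∑' n, f i n) := by
  induction n with
  | zero =>
    exact ⟨(hasSum_unique _).summable, by simp⟩
  | succ n ih =>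
    have h := ih (fun i => f ((finSuccEquiv n).symm (some i))) fun i => hf _
    have h' := hasSum_prod_pi_option (fun i => f ((finSuccEquiv n).symm i)) (fun i => hf _) h.1 h.2
    exact hasSum_prod_pi_equiv (finSuccEquiv n).symm f h'.1 h'.2

/-- A finite product of absolutely convergent series is the absolutely convergent series of the
products of their terms. -/
theorem hasSum_prod_pi {ι : Type*} [Fintype ι] (f : ι → ℕ → ℂ)
    (hf : ∀ i, Summable fun n => ‖f i n‖) :
    (Summable fun k : ι → ℕ => ‖∏ i, f i (k i)‖) ∧
      HasSum (fun k : ι → ℕ => ∏ i, f i (k i)) (∏ i, ∑' n, f i n) := by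
  have e := (Fintype.equivFin ι).symm
  have h := hasSum_prod_pi_fin _ (fun i => f (e i)) fun i => hf _
  exact hasSum_prod_pi_equiv e f h.1 h.2

/-! ### The binomial series and Beta laws -/

theorem hasSum_one_sub_cpow_neg (b : ℂ) {z : ℂ} (hz : ‖z‖ < 1) :
    HasSum (fun n : ℕ => pochhammerC b n / (n.factorial : ℂ) * z ^ n) ((1 - z) ^ (-b)) := by
  have h := (Complex.one_div_one_sub_cpow_hasFPowerSeriesOnBall_zero b).hasSum (y := z)
    (by rw [Metric.mem_eball, edist_zero_right, ← ofReal_norm]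
        exact ENNReal.ofReal_lt_one.2 hz)
  simp only [FormalMultilinearSeries.ofScalars_apply_eq, smul_eq_mul, zero_add, one_div,
    ← Complex.cpow_neg] at h
  refine h.congr_fun fun n => ?_
  have h1 := Ring.factorial_nsmul_multichoose_eq_ascPochhammer b n
  rw [Polynomial.ascPochhammer_smeval_eq_eval] at h1
  have : (n.factorial : ℂ) ≠ 0 := by exact_mod_cast n.factorial_ne_zero
  rw [pochhammerC, ← h1, ← Ring.multichoose_eq, nsmul_eq_mul]
  field_simp

theorem integral_betaMeasure {a b : ℝ} {E : Type*} [NormedAddCommGroup E] [NormedSpace ℝ E]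
    (ha : 0 < a) (hb : 0 < b) (f : ℝ → E) :
    ∫ u, f u ∂betaMeasure a b =
      ∫ u in Set.Ioo (0 : ℝ) 1, ((1 / beta a b) * u ^ (a - 1) * (1 - u) ^ (b - 1)) • f u := by
  have h0 : ∀ u, 0 ≤ betaPDFReal a b u := by
    intro u
    by_cases h : 0 < u ∧ u < 1
    · exact (betaPDFReal_pos h.1 h.2 ha hb).le
    · simp [betaPDFReal, h]
  rw [betaMeasure, integral_withDensity_eq_integral_toReal_smul
    (by unfold betaPDF; fun_prop) (by simp [betaPDF]), ← integral_indicator measurableSet_Ioo]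
  congr 1 with u
  rw [betaPDF, ENNReal.toReal_ofReal (h0 u), betaPDFReal, Set.indicator_apply]
  by_cases h : 0 < u ∧ u < 1
  · simp [h]
  · simp [h]

theorem ae_mem_Ioo_betaMeasure (a b : ℝ) : ∀ᵐ u ∂betaMeasure a b, u ∈ Set.Ioo (0 : ℝ) 1 := by
  rw [betaMeasure, ae_withDensity_iff (by unfold betaPDF; fun_prop)]
  refine ae_of_all _ fun u hu => ?_
  by_contra h
  exact hu (by simp [betaPDF, betaPDFReal, show ¬(0 < u ∧ u < 1) from h])

/-- Tilting a Beta density by a power of u gives another Beta density up to normalisation. It serves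
twice: for the moments, and to absorb the factor u^M of the error probability. -/
theorem integral_rpow_smul_betaMeasure {a b t : ℝ} {E : Type*} [NormedAddCommGroup E]
    [NormedSpace ℝ E] (ha : 0 < a) (hb : 0 < b) (ht : 0 ≤ t) (f : ℝ → E) :
    ∫ u, u ^ t • f u ∂betaMeasure a b =
      (beta (a + t) b / beta a b) • ∫ u, f u ∂betaMeasure (a + t) b := by
  rw [integral_betaMeasure ha hb, integral_betaMeasure (by positivity) hb, ← integral_smul]
  refine setIntegral_congr_fun measurableSet_Ioo fun u hu => ?_
  have h1 := (beta_pos ha hb).ne'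
  have h2 := (beta_pos (show 0 < a + t by positivity) hb).ne'
  simp only [smul_smul]
  congr 1
  rw [show a + t - 1 = (a - 1) + t by ring, Real.rpow_add hu.1]
  field_simp

/-- The moment is B(a+n, b)/B(a, b), a quotient of Gamma ratios. It supplies the coefficients
(a)_n/(c)_n of the Lauricella series. -/
theorem integral_pow_betaMeasure {a b : ℝ} (ha : 0 < a) (hb : 0 < b) (n : ℕ) :
    ((∫ u, u ^ n ∂betaMeasure a b : ℝ) : ℂ) = pochhammerC a n / pochhammerC (a + b) n := by
  have := isProbabilityMeasureBeta (show 0 < a + n by positivity) hb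
  have h := integral_rpow_smul_betaMeasure ha hb (Nat.cast_nonneg n) (fun _ => (1 : ℝ))
  simp only [Real.rpow_natCast, smul_eq_mul, mul_one, integral_const, probReal_univ] at h
  have hp {x : ℝ} (hx : 0 < x) :
      pochhammerC x n = ((Real.Gamma (x + n) / Real.Gamma x : ℝ) : ℂ) := by
    rw [pochhammerC, ← Complex.Gamma_add_nat_div_Gamma_eq]
    · push_cast [← Complex.Gamma_ofReal]
      rfl
    · intro k hk
      have : x = -(k : ℝ) := by exact_mod_cast hk
      linarith [(Nat.cast_nonneg k : (0 : ℝ) ≤ k)]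
  rw [h, ← Complex.ofReal_add, hp ha, hp (by positivity), ← Complex.ofReal_div]
  congr 1
  have h1 := (Real.Gamma_pos_of_pos ha).ne'
  have h2 := (Real.Gamma_pos_of_pos hb).ne'
  have h3 := (Real.Gamma_pos_of_pos (show 0 < a + b by positivity)).ne'
  have h4 := (Real.Gamma_pos_of_pos (show 0 < a + b + n by positivity)).ne'
  rw [beta, beta, show a + n + b = a + b + n by ring]
  field_simp

theorem integrable_betaMeasure_of_continuousOn {a b : ℝ} (ha : 0 < a) (hb : 0 < b)
    {E : Type*} [NormedAddCommGroup E] {f : ℝ → E} (hf : ContinuousOn f (Set.Icc 0 1)) :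
    Integrable f (betaMeasure a b) := by
  have := isProbabilityMeasureBeta ha hb
  have h : (betaMeasure a b).restrict (Set.Icc 0 1) = betaMeasure a b :=
    Measure.restrict_eq_self_of_ae_mem
      ((ae_mem_Ioo_betaMeasure a b).mono fun u hu => Set.Ioo_subset_Icc_self hu)
  rw [← h]
  exact hf.integrableOn_compact isCompact_Icc

/-! ### Euler's integral as the continuation of the Lauricella series -/

/-- Euler's integral for the Lauricella function `F_D(a; b; a + c)`. -/
def lauricellaEuler {ι : Type*} [Fintype ι] (a c : ℝ) (b : ι → ℂ) (z : ι → ℂ) : ℂ :=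
  ∫ u : ℝ, ∏ i, (1 - z i * u) ^ (-b i) ∂betaMeasure a c

/-- The point 1 - wu = (1-u)·1 + u(1-w) lies on the segment from 1 to 1 - w, and the slit plane is
star-shaped about 1. -/
theorem one_sub_mul_mem_slitPlane {w : ℂ} (hw : 1 - w ∈ Complex.slitPlane) {u : ℝ}
    (hu : u ∈ Set.Icc (0 : ℝ) 1) : 1 - w * u ∈ Complex.slitPlane := by
  have h := Complex.starConvex_one_slitPlane hw (sub_nonneg.2 hu.2) hu.1 (sub_add_cancel 1 u)
  convert h using 1
  simp only [Complex.real_smul]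
  push_cast
  ring

theorem isOpen_lauricellaFDDomain (ι : Type*) [Finite ι] : IsOpen (lauricellaFDDomain ι) := by
  rw [lauricellaFDDomain, Set.ofPred_forall]
  exact isOpen_iInter_of_finite fun i =>
    Complex.isOpen_slitPlane.preimage (by fun_prop : Continuous fun z : ι → ℂ => 1 - z i)

theorem contDiffOn_prod_one_sub_cpow {ι : Type*} [Fintype ι] (b : ι → ℂ) :
    ContDiffOn ℂ 1 (fun p : (ι → ℂ) × ℂ => ∏ i, (1 - p.1 i * p.2) ^ (-b i))
      {p | ∀ i, 1 - p.1 i * p.2 ∈ Complex.slitPlane} := by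
  refine contDiffOn_prod fun i _ p hp => ?_
  have h : ContDiffAt ℂ 1 (fun p : (ι → ℂ) × ℂ => 1 - p.1 i * p.2) p := by fun_prop
  have h2 : ContDiffAt ℂ 1 (fun w : ℂ => w ^ (-b i)) (1 - p.1 i * p.2) :=
    (AnalyticAt.cpow analyticAt_id analyticAt_const (hp i)).contDiffAt
  exact (h2.comp p h).contDiffWithinAt

theorem continuousOn_prod_one_sub_cpow {ι : Type*} [Fintype ι] (b : ι → ℂ) {z : ι → ℂ}
    (hz : z ∈ lauricellaFDDomain ι) :
    ContinuousOn (fun u : ℝ => ∏ i, (1 - z i * u) ^ (-b i)) (Set.Icc 0 1) := by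
  refine (contDiffOn_prod_one_sub_cpow b).continuousOn.comp
    (f := fun u : ℝ => (z, (u : ℂ))) (by fun_prop) ?_
  exact fun u hu i => one_sub_mul_mem_slitPlane (hz i) hu

/-- Differentiation under the integral sign. The endpoint singularities sit in the Beta measure, so
the integrand is C¹ near u in [0, 1], and a constant bound from compactness is integrable. -/
theorem differentiableOn_lauricellaEuler {ι : Type*} [Fintype ι] {a c : ℝ} (ha : 0 < a)
    (hc : 0 < c) (b : ι → ℂ) :
    DifferentiableOn ℂ (lauricellaEuler a c b) (lauricellaFDDomain ι) := by
  intro z₀ hz₀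
  set U : Set ((ι → ℂ) × ℂ) := {p | ∀ i, 1 - p.1 i * p.2 ∈ Complex.slitPlane} with hU
  have hUo : IsOpen U := by
    rw [hU, Set.ofPred_forall]
    exact isOpen_iInter_of_finite fun i => Complex.isOpen_slitPlane.preimage
      (by fun_prop : Continuous fun p : (ι → ℂ) × ℂ => 1 - p.1 i * p.2)
  set G : (ι → ℂ) × ℂ → ℂ := fun p => ∏ i, (1 - p.1 i * p.2) ^ (-b i)
  set G' : (ι → ℂ) × ℂ → ((ι → ℂ) →L[ℂ] ℂ) := fun p =>
    (fderiv ℂ G p).comp (ContinuousLinearMap.inl ℂ (ι → ℂ) ℂ)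
  have hcd : ContDiffOn ℂ 1 G U := contDiffOn_prod_one_sub_cpow b
  have hc1 : ContinuousOn (fderiv ℂ G) U := hcd.continuousOn_fderiv_of_isOpen hUo le_rfl
  have hG'c : ContinuousOn G' U := hc1.clm_comp continuousOn_const
  have hmem {z : ι → ℂ} (hz : z ∈ lauricellaFDDomain ι) {u : ℝ} (hu : u ∈ Set.Icc (0 : ℝ) 1) :
      (z, (u : ℂ)) ∈ U := fun i => one_sub_mul_mem_slitPlane (hz i) hu
  obtain ⟨K, hK, hzK, hKd⟩ := exists_compact_subset (isOpen_lauricellaFDDomain ι) hz₀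
  have hKI : K ×ˢ ((fun u : ℝ => (u : ℂ)) '' Set.Icc 0 1) ⊆ U := by
    rintro ⟨z, _⟩ ⟨hz, u, hu, rfl⟩
    exact hmem (hKd hz) hu
  obtain ⟨C, hC⟩ := (hK.prod
    (isCompact_Icc.image Complex.continuous_ofReal)).exists_bound_of_continuousOn (hG'c.mono hKI)
  have := isProbabilityMeasureBeta ha hc
  have hD : HasFDerivAt (lauricellaEuler a c b) (∫ u : ℝ, G' (z₀, u) ∂betaMeasure a c) z₀ := by
    refine hasFDerivAt_integral_of_dominated_of_fderiv_le (μ := betaMeasure a c) (bound := fun _ => C)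
      (F := fun z (u : ℝ) => G (z, u)) (F' := fun z u => G' (z, u))
      (mem_interior_iff_mem_nhds.1 hzK) ?_ ?_ ?_ ?_ (integrable_const _) ?_
    · filter_upwards [(isOpen_lauricellaFDDomain ι).mem_nhds hz₀] with z hz
      exact (integrable_betaMeasure_of_continuousOn ha hc
        (continuousOn_prod_one_sub_cpow b hz)).aestronglyMeasurable
    · exact integrable_betaMeasure_of_continuousOn ha hc (continuousOn_prod_one_sub_cpow b hz₀)
    · exact (integrable_betaMeasure_of_continuousOn ha hc (hG'c.comp
        (f := fun u : ℝ => (z₀, (u : ℂ))) (by fun_prop) fun u hu => hmem hz₀ hu)).aestronglyMeasurable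
    · filter_upwards [ae_mem_Ioo_betaMeasure a c] with u hu z hz
      exact hC _ ⟨hz, u, Set.Ioo_subset_Icc_self hu, rfl⟩
    · filter_upwards [ae_mem_Ioo_betaMeasure a c] with u hu z hz
      have hd : HasFDerivAt G (fderiv ℂ G (z, (u : ℂ))) (z, (u : ℂ)) :=
        ((hcd.differentiableOn one_ne_zero).differentiableAt
          (hUo.mem_nhds (hmem (hKd hz) (Set.Ioo_subset_Icc_self hu)))).hasFDerivAt
      exact HasFDerivAt.comp (f := fun e => (e, (u : ℂ))) z hd (hasFDerivAt_prodMk_left z (u : ℂ))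
  exact hD.differentiableAt.differentiableWithinAt

/-- Each factor is expanded by the binomial series, the series are multiplied, and the result is
integrated term by term. Since 0 < u < 1, the terms at u = 1 dominate. -/
theorem hasSum_lauricellaEuler {ι : Type*} [Fintype ι] {a c : ℝ} (ha : 0 < a) (hc : 0 < c)
    (b : ι → ℂ) {z : ι → ℂ} (hz : ∀ i, ‖z i‖ < 1) :
    HasSum (lauricellaFDTerm a b ((a + c : ℝ) : ℂ) z) (lauricellaEuler a c b z) := by
  have := isProbabilityMeasureBeta ha hc
  set A : ι → ℕ → ℂ := fun i n => pochhammerC (b i) n / (n.factorial : ℂ) with hA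
  have hs {x : ι → ℂ} (hx : ∀ i, ‖x i‖ < 1) := hasSum_prod_pi (fun i n => A i n * x i ^ n)
    fun i => (hasSum_one_sub_cpow_neg (b i) (hx i)).summable.norm
  have hterm (k : ι → ℕ) : lauricellaFDTerm a b ((a + c : ℝ) : ℂ) z k =
      ∫ u : ℝ, ∏ i, (A i (k i) * (z i * u) ^ k i) ∂betaMeasure a c := by
    have h1 (u : ℝ) : ∏ i, (A i (k i) * (z i * u) ^ k i) =
        (∏ i, (A i (k i) * z i ^ k i)) * ((u ^ (∑ i, k i) : ℝ) : ℂ) := by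
      rw [Complex.ofReal_pow, ← Finset.prod_pow_eq_pow_sum, ← Finset.prod_mul_distrib]
      exact Finset.prod_congr rfl fun i _ => by ring
    simp_rw [h1]
    rw [integral_const_mul, integral_complex_ofReal, integral_pow_betaMeasure ha hc,
      lauricellaFDTerm]
    simp only [hA, Finset.prod_mul_distrib, Finset.prod_div_distrib]
    push_cast
    ring
  rw [show lauricellaFDTerm a b ((a + c : ℝ) : ℂ) z = _ from funext hterm]
  refine hasSum_integral_of_dominated_convergence
    (fun k _ => ‖∏ i, (A i (k i) * z i ^ k i)‖) ?_ ?_ ?_ ?_ ?_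
  · intro k
    exact (by fun_prop : Continuous fun u : ℝ =>
      ∏ i, (A i (k i) * (z i * u) ^ k i)).aestronglyMeasurable
  · intro k
    filter_upwards [ae_mem_Ioo_betaMeasure a c] with u hu
    rw [norm_prod, norm_prod]
    refine Finset.prod_le_prod (fun _ _ => norm_nonneg _) fun i _ => ?_
    rw [norm_mul, norm_mul, norm_pow, norm_pow, norm_mul]
    gcongr
    refine mul_le_of_le_one_right (norm_nonneg _) ?_
    rw [Complex.norm_real, Real.norm_of_nonneg hu.1.le]
    exact hu.2.le
  · exact ae_of_all _ fun _ => (hs hz).1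
  · exact integrable_const _
  · filter_upwards [ae_mem_Ioo_betaMeasure a c] with u hu
    have hzu (i) : ‖z i * u‖ < 1 := by
      rw [norm_mul, Complex.norm_real, Real.norm_of_nonneg hu.1.le]
      nlinarith [norm_nonneg (z i), hz i, hu.1, hu.2]
    rw [show ∏ i, (1 - z i * (u : ℂ)) ^ (-b i) = ∏ i, ∑' n, A i n * (z i * u) ^ n from
      Finset.prod_congr rfl fun i _ => (hasSum_one_sub_cpow_neg (b i) (hzu i)).tsum_eq.symm]
    exact (hs hzu).2

theorem isLauricellaFD_lauricellaEuler {ι : Type*} [Fintype ι] {a c : ℝ} (ha : 0 < a)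
    (hc : 0 < c) (b : ι → ℂ) :
    IsLauricellaFD a b ((a + c : ℝ) : ℂ) (lauricellaEuler a c b) :=
  ⟨fun _ hz => hasSum_lauricellaEuler ha hc b hz, differentiableOn_lauricellaEuler ha hc b⟩

/-! ### Craig's formula -/

theorem integral_mul_exp_neg_sq_mul_Ioi {b : ℝ} (hb : 0 < b) (x : ℝ) :
    IntegrableOn (fun s => s * Real.exp (-(s ^ 2 * b) / 2)) (Set.Ioi x) ∧
    ∫ s in Set.Ioi x, s * Real.exp (-(s ^ 2 * b) / 2) = Real.exp (-(x ^ 2 * b) / 2) / b := by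
  have hint : Integrable (fun s : ℝ => s * Real.exp (-(s ^ 2 * b) / 2)) := by
    convert integrable_mul_exp_neg_mul_sq (half_pos hb) using 4
    ring
  refine ⟨hint.integrableOn, ?_⟩
  have hd (s : ℝ) : HasDerivAt (fun s => -(Real.exp (-(s ^ 2 * b) / 2) / b))
      (s * Real.exp (-(s ^ 2 * b) / 2)) s := by
    have h := (((((hasDerivAt_id s).pow 2).mul_const b).neg.div_const 2).exp.div_const b).neg
    refine h.congr_deriv ?_
    simp only [id_eq, Pi.pow_apply]
    field_simp
    simp
    ring_nf
  have ht : Filter.Tendsto (fun s : ℝ => -(Real.exp (-(s ^ 2 * b) / 2) / b)) Filter.atTop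
      (nhds (-(0 / b))) := by
    refine (Filter.Tendsto.div_const ?_ b).neg
    refine Real.tendsto_exp_neg_atTop_nhds_zero.comp (f := fun s : ℝ => s ^ 2 * b / 2) ?_ |>.congr
      fun s => by simp [neg_div]
    exact ((Filter.tendsto_pow_atTop two_ne_zero).atTop_mul_const hb).atTop_div_const two_pos
  rw [integral_Ioi_of_hasDerivAt_of_tendsto' (fun s _ => hd s) hint.integrableOn ht]
  simp

/-- The integrand is itself an integral over s > x of s·exp(-s²(1+y²)/2). After swapping, the
Gaussian integral in y produces 1/s, which cancels the factor s. -/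
theorem integral_exp_neg_div_one_add_sq {x : ℝ} (hx : 0 ≤ x) :
    ∫ y in Set.Ioi (0 : ℝ), Real.exp (-(x ^ 2 * (1 + y ^ 2)) / 2) / (1 + y ^ 2) =
      Real.sqrt (Real.pi / 2) * ∫ s in Set.Ioi x, Real.exp (-(s ^ 2) / 2) := by
  have hpos (y : ℝ) : 0 < 1 + y ^ 2 := by positivity
  have h1 (y : ℝ) := integral_mul_exp_neg_sq_mul_Ioi (hpos y) x
  simp_rw [← (h1 _).2]
  rw [integral_integral_swap, ← integral_const_mul]
  · refine setIntegral_congr_fun measurableSet_Ioi fun s hs => ?_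
    have hs0 : 0 < s := hx.trans_lt hs
    have h2 (y : ℝ) : s * Real.exp (-(s ^ 2 * (1 + y ^ 2)) / 2) =
        s * Real.exp (-(s ^ 2) / 2) * Real.exp (-(s ^ 2 / 2) * y ^ 2) := by
      rw [mul_assoc, ← Real.exp_add]
      ring_nf
    simp_rw [h2]
    rw [integral_const_mul, integral_gaussian_Ioi,
      show Real.pi / (s ^ 2 / 2) = (Real.pi / 2) * (2 / s) ^ 2 by field_simp,
      Real.sqrt_mul (by positivity), Real.sqrt_sq (by positivity)]
    field_simp
  · rw [integrable_prod_iff (by fun_prop)]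
    refine ⟨ae_of_all _ fun y => (h1 y).1, ?_⟩
    have h3 (y : ℝ) : ∫ s in Set.Ioi x, ‖s * Real.exp (-(s ^ 2 * (1 + y ^ 2)) / 2)‖ =
        Real.exp (-(x ^ 2 * (1 + y ^ 2)) / 2) / (1 + y ^ 2) := by
      rw [← (h1 y).2]
      refine setIntegral_congr_fun measurableSet_Ioi fun s hs => ?_
      have hs0 : 0 < s := hx.trans_lt hs
      exact Real.norm_of_nonneg (by positivity)
    simp only [Function.uncurry]
    simp_rw [h3]
    refine integrable_inv_one_add_sq.integrableOn.mono'
      (Measurable.aestronglyMeasurable (by fun_prop)) (ae_of_all _ fun y => ?_)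
    rw [Real.norm_of_nonneg (by positivity), div_eq_mul_inv]
    refine mul_le_of_le_one_left (by positivity) (Real.exp_le_one_iff.2 ?_)
    have := hpos y
    rw [neg_div]
    exact neg_nonpos.2 (by positivity)

theorem beta_half_half : beta (1 / 2) (1 / 2) = Real.pi := by
  rw [beta, Real.Gamma_one_half_eq, Real.mul_self_sqrt Real.pi_pos.le]
  norm_num

theorem image_inv_one_add_sq_Ioi :
    (fun y : ℝ => (1 + y ^ 2)⁻¹) '' Set.Ioi 0 = Set.Ioo 0 1 := by
  ext u
  constructor
  · rintro ⟨y, hy, rfl⟩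
    have : (0 : ℝ) < y ^ 2 := pow_pos hy 2
    exact ⟨by positivity, inv_lt_one_of_one_lt₀ (by linarith)⟩
  · rintro ⟨h0, h1⟩
    have h : 0 < u⁻¹ - 1 := sub_pos.2 ((one_lt_inv₀ h0).2 h1)
    refine ⟨Real.sqrt (u⁻¹ - 1), Real.sqrt_pos.2 h, ?_⟩
    simp [Real.sq_sqrt h.le]

theorem injOn_inv_one_add_sq : Set.InjOn (fun y : ℝ => (1 + y ^ 2)⁻¹) (Set.Ioi 0) := by
  intro y hy y' hy' h
  have h1 : y ^ 2 = y' ^ 2 := by simpa using h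
  exact (pow_left_inj₀ (le_of_lt hy) (le_of_lt hy') two_ne_zero).1 h1

/-- The arcsine law in the variable `u = 1 / (1 + y ^ 2)`. -/
theorem integral_betaMeasure_half_half (f : ℝ → ℝ) :
    ∫ u, f u ∂betaMeasure (1 / 2) (1 / 2) =
      2 / Real.pi * ∫ y in Set.Ioi (0 : ℝ), f (1 + y ^ 2)⁻¹ / (1 + y ^ 2) := by
  rw [integral_betaMeasure (by norm_num) (by norm_num), ← image_inv_one_add_sq_Ioi,
    integral_image_eq_integral_abs_deriv_smul measurableSet_Ioi
      (f' := fun y => -(2 * y) / (1 + y ^ 2) ^ 2) ?_ injOn_inv_one_add_sq, ← integral_const_mul]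
  · refine setIntegral_congr_fun measurableSet_Ioi fun y hy => ?_
    have hy0 : 0 < y := hy
    have hpos : 0 < 1 + y ^ 2 := by positivity
    have hsub : 1 - (1 + y ^ 2)⁻¹ = y ^ 2 * (1 + y ^ 2)⁻¹ := by
      field_simp
      ring
    have hhalf : ((1 : ℝ) / 2 - 1) = -(1 / 2) := by norm_num
    simp only [smul_eq_mul, beta_half_half, hsub, hhalf]
    rw [Real.mul_rpow (by positivity) (by positivity), Real.rpow_neg (by positivity),
      Real.rpow_neg (by positivity), ← Real.sqrt_eq_rpow, ← Real.sqrt_eq_rpow,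
      Real.sqrt_sq hy0.le, abs_div, abs_neg, abs_of_pos (by positivity : 0 < 2 * y),
      abs_of_pos (by positivity : 0 < (1 + y ^ 2) ^ 2), Real.sqrt_inv, inv_inv]
    have h2 := Real.mul_self_sqrt hpos.le
    have := Real.pi_pos
    field_simp
    rw [sq (Real.sqrt _), h2]
  · intro y _
    have hpos : 1 + y ^ 2 ≠ 0 := by positivity
    have := (((hasDerivAt_id y).pow 2).const_add 1).inv hpos
    refine (this.congr_deriv ?_).hasDerivWithinAt
    simp

/-- **Craig's formula** for the Gaussian tail function. -/
theorem gaussianQ_sqrt {v : ℝ} (hv : 0 ≤ v) :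
    gaussianQ (Real.sqrt v) =
      1 / 2 * ∫ u, Real.exp (-(v / (2 * u))) ∂betaMeasure (1 / 2) (1 / 2) := by
  have h := integral_exp_neg_div_one_add_sq (Real.sqrt_nonneg v)
  rw [Real.sq_sqrt hv] at h
  have h2 (y : ℝ) : -(v / (2 * (1 + y ^ 2)⁻¹)) = -(v * (1 + y ^ 2)) / 2 := by
    field_simp
  rw [integral_betaMeasure_half_half]
  simp_rw [h2]
  rw [h, gaussianQ]
  have h3 : 1 / 2 * (2 / Real.pi * Real.sqrt (Real.pi / 2)) = 1 / Real.sqrt (2 * Real.pi) := by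
    rw [Real.sqrt_div' _ two_pos.le, Real.sqrt_mul two_pos.le]
    have := Real.pi_pos
    have h4 := Real.mul_self_sqrt Real.pi_pos.le
    field_simp
    nlinarith
  rw [← h3]
  ring

/-! ### The conditional density as a Poisson mixture of Gamma densities -/

theorem summable_pow_div_factorial_mul_Gamma {μ : ℝ} (hμ : 0 < μ) {y : ℝ} (hy : 0 ≤ y) :
    Summable fun k : ℕ => y ^ k / ((k.factorial : ℝ) * Real.Gamma (k + μ)) := by
  have hG (k : ℕ) : 0 < Real.Gamma (k + μ) := Real.Gamma_pos_of_pos (by positivity)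
  refine summable_of_ratio_norm_eventually_le (r := 1 / 2) (by norm_num) ?_
  -- The ratio of consecutive terms is y/((n+1)(n+μ)), at most 1/2 once n ≥ 2y.
  filter_upwards [Filter.eventually_ge_atTop (max 1 ⌈2 * y⌉₊)] with n hn
  have hn1 : (1 : ℝ) ≤ n := by exact_mod_cast (le_max_left _ _).trans hn
  have hny : 2 * y ≤ n := (Nat.le_ceil _).trans (by exact_mod_cast (le_max_right _ _).trans hn)
  have hr : Real.Gamma (((n + 1 : ℕ) : ℝ) + μ) = (n + μ) * Real.Gamma (n + μ) := by
    rw [← Real.Gamma_add_one (by positivity)]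
    push_cast
    ring_nf
  have h1 := hG n
  rw [hr, Real.norm_of_nonneg (by positivity), Real.norm_of_nonneg (by positivity)]
  have : y ^ (n + 1) / (((n + 1).factorial : ℝ) * ((n + μ) * Real.Gamma (n + μ))) =
      y / ((n + 1) * (n + μ)) * (y ^ n / ((n.factorial : ℝ) * Real.Gamma (n + μ))) := by
    rw [Nat.factorial_succ]
    push_cast
    field_simp
    ring
  rw [this]
  refine mul_le_mul_of_nonneg_right ?_ (by positivity)
  rw [div_le_iff₀ (by positivity)]
  nlinarith

/-- The Bessel argument is 2√Y, so the series carries a factor Y^((μ-1)/2) whose power of κ cancels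
the one in the denominator. The resulting form also covers κ = 0, where only the term k = 0
survives. -/
theorem kappaMuCondPDF_eq {gbar κ μ ξ x : ℝ} (hg : 0 < gbar) (hκ : 0 ≤ κ) (hμ : 0 < μ)
    (hξ : 0 < ξ) (hx : 0 < x) :
    kappaMuCondPDF gbar κ μ ξ x =
      Real.exp (-(ξ ^ 2 * μ * κ)) * (μ * (1 + κ) / gbar) ^ μ * x ^ (μ - 1) *
        Real.exp (-(μ * (1 + κ) / gbar * x)) *
        ∑' k : ℕ, (ξ ^ 2 * μ * κ * (μ * (1 + κ) / gbar * x)) ^ k /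
          ((k.factorial : ℝ) * Real.Gamma (k + μ)) := by
  rcases hκ.eq_or_lt with rfl | hκ
  · rw [tsum_eq_single 0 (fun k hk => by simp [hk])]
    simp only [kappaMuCondPDF, if_true, gammaPDFReal, if_pos hx.le]
    simp
    ring
  · set p := (μ - 1) / 2 with hp
    set Y := ξ ^ 2 * μ * κ * (μ * (1 + κ) / gbar * x) with hY
    have hY0 : 0 < Y := by positivity
    have hX : (2 * μ * ξ * Real.sqrt (κ * (1 + κ) * x / gbar) / 2) = Real.sqrt Y := by
      have : Y = (μ * ξ) ^ 2 * (κ * (1 + κ) * x / gbar) := by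
        rw [hY]
        ring
      rw [this, Real.sqrt_mul (by positivity), Real.sqrt_sq (by positivity)]
      ring
    have hb : besselI (μ - 1) (2 * μ * ξ * Real.sqrt (κ * (1 + κ) * x / gbar)) =
        Y ^ p * ∑' k : ℕ, Y ^ k / ((k.factorial : ℝ) * Real.Gamma (k + μ)) := by
      rw [besselI, ← tsum_mul_left]
      refine tsum_congr fun k => ?_
      rw [hX, Real.sqrt_eq_rpow, ← Real.rpow_mul hY0.le,
        show 1 / 2 * (2 * (k : ℝ) + (μ - 1)) = p + k by rw [hp]; ring, Real.rpow_add hY0,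
        Real.rpow_natCast, show (k : ℝ) + (μ - 1) + 1 = k + μ by ring]
      ring
    rw [kappaMuCondPDF, if_neg hκ.ne', hb, ← hp, ← mul_assoc]
    congr 1
    have h1 : (1 + κ) ^ ((μ + 1) / 2) = (1 + κ) ^ p * (1 + κ) := by
      rw [show (μ + 1) / 2 = p + 1 by rw [hp]; ring, Real.rpow_add_one (by positivity)]
    have h2 : (μ * (1 + κ) / gbar) ^ μ * x ^ (μ - 1) =
        μ * (1 + κ) / gbar * ((1 + κ) ^ p / κ ^ p * (x / (ξ ^ 2 * gbar)) ^ p * Y ^ p) := by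
      rw [← Real.div_rpow (by positivity) hκ.le, ← Real.mul_rpow (by positivity) (by positivity),
        ← Real.mul_rpow (by positivity) (by positivity),
        show (1 + κ) / κ * (x / (ξ ^ 2 * gbar)) * Y = (μ * (1 + κ) / gbar * x) ^ (2 : ℝ) by
          rw [hY, Real.rpow_two]
          field_simp,
        ← Real.rpow_mul (by positivity), show 2 * p = μ - 1 by rw [hp]; ring,
        Real.mul_rpow (by positivity) hx.le, ← mul_assoc]
      congr 1
      rw [← Real.rpow_one_add' (by positivity) (by linarith)]
      congr 1
      ring
    rw [h1, mul_assoc (Real.exp _), h2, Real.exp_neg (ξ ^ 2 * μ * κ),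
      show μ * (1 + κ) * x / gbar = μ * (1 + κ) / gbar * x by ring]
    field_simp

/-- The `κ`-`μ` density is a Poisson mixture of Gamma densities. -/
theorem ofReal_kappaMuCondPDF {gbar κ μ ξ x : ℝ} (hg : 0 < gbar) (hκ : 0 ≤ κ) (hμ : 0 < μ)
    (hξ : 0 < ξ) (hx : 0 < x) :
    ENNReal.ofReal (kappaMuCondPDF gbar κ μ ξ x) =
      ∑' k : ℕ, ENNReal.ofReal (Real.exp (-(ξ ^ 2 * μ * κ)) * (ξ ^ 2 * μ * κ) ^ k / k.factorial) *
        gammaPDF (μ + k) (μ * (1 + κ) / gbar) x := by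
  set a := μ * (1 + κ) / gbar with ha
  set q := ξ ^ 2 * μ * κ with hq
  have ha0 : 0 < a := by positivity
  have hq0 : 0 ≤ q := by positivity
  rw [kappaMuCondPDF_eq hg hκ hμ hξ hx, ← ha, ← hq, ← tsum_mul_left, ENNReal.ofReal_tsum_of_nonneg]
  · refine tsum_congr fun k => ?_
    rw [gammaPDF_of_nonneg hx.le, ← ENNReal.ofReal_mul (by positivity), Real.rpow_add ha0,
      Real.rpow_natCast, show μ + k - 1 = (μ - 1) + k by ring, Real.rpow_add hx, Real.rpow_natCast,
      mul_pow, mul_pow, add_comm μ]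
    congr 1
    ring_nf
  · intro k
    have := Real.Gamma_pos_of_pos (show 0 < (k : ℝ) + μ by positivity)
    positivity
  · exact (summable_pow_div_factorial_mul_Gamma hμ (by positivity)).mul_left _

/-! ### Laplace transform of the shadowed law -/

/-- Exponential tilting only moves the Gamma rate from a to a + s, up to a constant. -/
theorem lintegral_gammaPDF_mul_exp {p a s : ℝ} (hp : 0 < p) (ha : 0 < a) (hs : 0 ≤ s) :
    ∫⁻ x in Set.Ioi (0 : ℝ), gammaPDF p a x * ENNReal.ofReal (Real.exp (-(s * x))) =
      ENNReal.ofReal ((a / (a + s)) ^ p) := by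
  have has : 0 < a + s := by positivity
  have h (x : ℝ) (hx : x ∈ Set.Ioi (0 : ℝ)) :
      gammaPDF p a x * ENNReal.ofReal (Real.exp (-(s * x))) =
        ENNReal.ofReal ((a / (a + s)) ^ p) * gammaPDF p (a + s) x := by
    have hx0 : 0 < x := hx
    have := Real.Gamma_pos_of_pos hp
    rw [gammaPDF_of_nonneg hx0.le, gammaPDF_of_nonneg hx0.le, ← ENNReal.ofReal_mul (by positivity),
      ← ENNReal.ofReal_mul (by positivity), Real.div_rpow ha.le has.le,
      show -((a + s) * x) = -(a * x) + -(s * x) by ring, Real.exp_add]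
    congr 1
    field_simp
  rw [setLIntegral_congr_fun measurableSet_Ioi h, lintegral_const_mul _ (by
    unfold gammaPDF; fun_prop), setLIntegral_congr Ioi_ae_eq_Ici,
    setLIntegral_eq_of_support_subset, lintegral_gammaPDF_eq_one hp has, mul_one]
  intro x hx
  by_contra h0
  exact hx (gammaPDF_of_neg (not_le.1 h0))

theorem nakagamiPDF_nonneg {m ξ : ℝ} (hm : 0 < m) (hξ : 0 < ξ) : 0 ≤ nakagamiPDF m ξ := by
  have := Real.Gamma_pos_of_pos hm
  unfold nakagamiPDF
  positivity

theorem measurable_nakagamiPDF (m : ℝ) : Measurable (nakagamiPDF m) := by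
  unfold nakagamiPDF
  fun_prop

theorem lintegral_nakagamiPDF_mul_exp {m t : ℝ} (hm : 0 < m) (ht : 0 ≤ t) :
    ∫⁻ ξ in Set.Ioi (0 : ℝ), ENNReal.ofReal (nakagamiPDF m ξ * Real.exp (-(t * ξ ^ 2))) =
      ENNReal.ofReal ((m / (m + t)) ^ m) := by
  have hG := Real.Gamma_pos_of_pos hm
  have hmt : 0 < m + t := by positivity
  have h1 : ∫ ξ in Set.Ioi (0 : ℝ), nakagamiPDF m ξ * Real.exp (-(t * ξ ^ 2)) =
      (m / (m + t)) ^ m := by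
    have h (ξ : ℝ) : nakagamiPDF m ξ * Real.exp (-(t * ξ ^ 2)) =
        2 * m ^ m / Real.Gamma m * (ξ ^ (2 * m - 1) * Real.exp (-(m + t) * ξ ^ (2 : ℝ))) := by
      rw [nakagamiPDF, mul_assoc, ← Real.exp_add, Real.rpow_two, mul_assoc]
      ring_nf
    simp_rw [h]
    rw [integral_const_mul, integral_rpow_mul_exp_neg_mul_rpow two_pos (by linarith) hmt,
      show (2 * m - 1 + 1) / 2 = m by ring, show -(2 * m - 1 + 1) / 2 = -m by ring,
      Real.rpow_neg hmt.le, Real.div_rpow hm.le hmt.le]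
    field_simp
  rw [← h1, ofReal_integral_eq_lintegral_ofReal]
  -- A non-integrable function would have Bochner integral 0, so the positive value just computed
  -- yields integrability.
  · exact .of_integral_ne_zero (by rw [h1]; positivity)
  · filter_upwards [ae_restrict_mem measurableSet_Ioi] with ξ hξ
    exact mul_nonneg (nakagamiPDF_nonneg hm hξ) (Real.exp_nonneg _)

/-- The Poisson weights of the `κ`-`μ` mixture, averaged over the shadowing amplitude. -/
def kappaMuShadowedWeight (κ μ m : ℝ) (k : ℕ) : ENNReal :=
  ∫⁻ ξ in Set.Ioi (0 : ℝ), ENNReal.ofReal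
    (Real.exp (-(ξ ^ 2 * μ * κ)) * (ξ ^ 2 * μ * κ) ^ k / k.factorial) *
      ENNReal.ofReal (nakagamiPDF m ξ)

theorem kappaMuShadowed_eq {gbar κ μ m : ℝ} (hg : 0 < gbar) (hκ : 0 ≤ κ) (hμ : 0 < μ)
    (hm : 0 < m) :
    kappaMuShadowed gbar κ μ m = (volume.restrict (Set.Ioi 0)).withDensity fun x =>
      ∑' k : ℕ, kappaMuShadowedWeight κ μ m k * gammaPDF (μ + k) (μ * (1 + κ) / gbar) x := by
  have hN := measurable_nakagamiPDF m
  refine withDensity_congr_ae ?_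
  filter_upwards [ae_restrict_mem measurableSet_Ioi] with x hx
  simp_rw [kappaMuShadowedWeight]
  have h (ξ : ℝ) (hξ : ξ ∈ Set.Ioi (0 : ℝ)) :
      ENNReal.ofReal (kappaMuCondPDF gbar κ μ ξ x * nakagamiPDF m ξ) =
        ∑' k : ℕ, ENNReal.ofReal
          (Real.exp (-(ξ ^ 2 * μ * κ)) * (ξ ^ 2 * μ * κ) ^ k / k.factorial) *
            ENNReal.ofReal (nakagamiPDF m ξ) * gammaPDF (μ + k) (μ * (1 + κ) / gbar) x := by
    rw [ENNReal.ofReal_mul' (nakagamiPDF_nonneg hm hξ), ofReal_kappaMuCondPDF hg hκ hμ hξ hx,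
      ← ENNReal.tsum_mul_right]
    exact tsum_congr fun k => by ring
  rw [setLIntegral_congr_fun measurableSet_Ioi h, lintegral_tsum fun k => by fun_prop]
  exact tsum_congr fun k => lintegral_mul_const _ (by fun_prop)

/-- In `ENNReal` every interchange is Tonelli. The factors ρ^k resum the Poisson series to
exp(ξ²μκρ), leaving exp(-ξ²μκ(1-ρ)) to average over ξ. -/
theorem lintegral_exp_kappaMuShadowed {gbar κ μ m s : ℝ} (hg : 0 < gbar) (hκ : 0 ≤ κ)
    (hμ : 0 < μ) (hm : 0 < m) (hs : 0 ≤ s) {a ρ : ℝ} (ha : a = μ * (1 + κ) / gbar)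
    (hρ : ρ = a / (a + s)) :
    ∫⁻ x, ENNReal.ofReal (Real.exp (-(s * x))) ∂kappaMuShadowed gbar κ μ m =
      ENNReal.ofReal (ρ ^ μ * (m / (m + μ * κ * (1 - ρ))) ^ m) := by
  have hN := measurable_nakagamiPDF m
  have ha0 : 0 < a := by rw [ha]; positivity
  have hρ0 : 0 < ρ := by rw [hρ]; positivity
  have hρ1 : ρ ≤ 1 := by rw [hρ, div_le_one (by positivity)]; linarith
  have hgm (p : ℝ) : Measurable (gammaPDF p a) := by unfold gammaPDF; fun_prop
  rw [kappaMuShadowed_eq hg hκ hμ hm, ← ha, lintegral_withDensity_eq_lintegral_mul₀ (by fun_prop)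
    (by fun_prop)]
  simp only [Pi.mul_apply, ← ENNReal.tsum_mul_right]
  rw [lintegral_tsum fun k => by fun_prop]
  have h1 (k : ℕ) : ∫⁻ x in Set.Ioi (0 : ℝ), kappaMuShadowedWeight κ μ m k *
      gammaPDF (μ + k) a x * ENNReal.ofReal (Real.exp (-(s * x))) =
      ∫⁻ ξ in Set.Ioi (0 : ℝ), ENNReal.ofReal
        (Real.exp (-(ξ ^ 2 * μ * κ)) * (ξ ^ 2 * μ * κ) ^ k / k.factorial) *
          ENNReal.ofReal (nakagamiPDF m ξ) * ENNReal.ofReal (ρ ^ (μ + k)) := by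
    simp only [mul_assoc (kappaMuShadowedWeight κ μ m k)]
    rw [lintegral_const_mul _ (by fun_prop), lintegral_gammaPDF_mul_exp (by positivity) ha0 hs,
      ← hρ, kappaMuShadowedWeight, lintegral_mul_const _ (by fun_prop)]
  simp_rw [h1]
  rw [← lintegral_tsum fun k => by fun_prop, ENNReal.ofReal_mul (by positivity),
    ← lintegral_nakagamiPDF_mul_exp hm (mul_nonneg (by positivity) (sub_nonneg.2 hρ1)),
    ← lintegral_const_mul _ (by fun_prop)]
  refine setLIntegral_congr_fun measurableSet_Ioi fun ξ hξ => ?_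
  have hξ0 : 0 < ξ := hξ
  have hn := nakagamiPDF_nonneg hm hξ0
  have h2 (k : ℕ) : ENNReal.ofReal
        (Real.exp (-(ξ ^ 2 * μ * κ)) * (ξ ^ 2 * μ * κ) ^ k / k.factorial) *
          ENNReal.ofReal (nakagamiPDF m ξ) * ENNReal.ofReal (ρ ^ (μ + k)) =
      ENNReal.ofReal (ρ ^ μ * nakagamiPDF m ξ * Real.exp (-(ξ ^ 2 * μ * κ)) *
        ((ξ ^ 2 * μ * κ * ρ) ^ k / k.factorial)) := by
    rw [← ENNReal.ofReal_mul (by positivity), ← ENNReal.ofReal_mul (by positivity),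
      Real.rpow_add hρ0, Real.rpow_natCast, mul_pow _ ρ]
    congr 1
    ring
  have hexp := NormedSpace.expSeries_div_hasSum_exp (ξ ^ 2 * μ * κ * ρ)
  rw [← Real.exp_eq_exp_ℝ] at hexp
  simp_rw [h2]
  rw [← ENNReal.ofReal_tsum_of_nonneg (fun k => by positivity) (hexp.summable.mul_left _),
    tsum_mul_left, hexp.tsum_eq, ← ENNReal.ofReal_mul (by positivity), mul_assoc, mul_assoc,
    mul_assoc, ← Real.exp_add]
  ring_nf

/-! ### Averaging the tail function over the combined SNR -/

theorem integral_gaussianQ_sqrt_mul {Ω : Type*} [MeasurableSpace Ω] {P : Measure Ω}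
    [IsProbabilityMeasure P] {S : Ω → ℝ} (hS : AEMeasurable S P) (hS0 : ∀ᵐ ω ∂P, 0 ≤ S ω)
    {β : ℝ} (hβ : 0 < β) :
    ∫ ω, gaussianQ (Real.sqrt (β * S ω)) ∂P =
      1 / 2 * ∫ u, mgf S P (-(β / (2 * u))) ∂betaMeasure (1 / 2) (1 / 2) := by
  have := isProbabilityMeasureBeta (show (0 : ℝ) < 1 / 2 by norm_num)
    (show (0 : ℝ) < 1 / 2 by norm_num)
  have h1 : ∀ᵐ ω ∂P, gaussianQ (Real.sqrt (β * S ω)) =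
      1 / 2 * ∫ u, Real.exp (-(β * S ω / (2 * u))) ∂betaMeasure (1 / 2) (1 / 2) := by
    filter_upwards [hS0] with ω hω
    exact gaussianQ_sqrt (mul_nonneg hβ.le hω)
  rw [integral_congr_ae h1, integral_const_mul, integral_integral_swap]
  · congr 2 with u
    simp only [mgf]
    congr 1 with ω
    ring_nf
  -- Fubini applies because the integrand is at most 1 on a product of probability spaces.
  · refine (integrable_const (1 : ℝ)).mono' ?_ ?_
    · have hS' : AEMeasurable (fun p : Ω × ℝ => S p.1) (P.prod (betaMeasure (1 / 2) (1 / 2))) :=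
        hS.comp_fst
      exact AEMeasurable.aestronglyMeasurable (by unfold Function.uncurry; fun_prop)
    · filter_upwards [Measure.quasiMeasurePreserving_fst.ae hS0,
        Measure.quasiMeasurePreserving_snd.ae (ae_mem_Ioo_betaMeasure (1 / 2) (1 / 2))] with p hp hu
      have := hu.1
      rw [Function.uncurry, Real.norm_of_nonneg (Real.exp_nonneg _), Real.exp_le_one_iff,
        Left.neg_nonpos_iff]
      positivity

theorem ae_nonneg_of_hasLaw_kappaMuShadowed {Ω : Type*} [MeasurableSpace Ω] {P : Measure Ω}
    {γ : Ω → ℝ} {gbar κ μ m : ℝ} (h : HasLaw γ (kappaMuShadowed gbar κ μ m) P) :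
    ∀ᵐ ω ∂P, 0 ≤ γ ω := by
  have h1 : ∀ᵐ x ∂kappaMuShadowed gbar κ μ m, 0 ≤ x :=
    (withDensity_absolutelyContinuous _ _).ae_le
      ((ae_restrict_mem measurableSet_Ioi).mono fun x hx => le_of_lt hx)
  rw [← h.map_eq] at h1
  exact ae_of_ae_map h.aemeasurable h1

theorem mgf_neg_of_hasLaw_kappaMuShadowed {Ω : Type*} [MeasurableSpace Ω] {P : Measure Ω}
    {γ : Ω → ℝ} {gbar κ μ m : ℝ} (h : HasLaw γ (kappaMuShadowed gbar κ μ m) P)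
    (hg : 0 < gbar) (hκ : 0 ≤ κ) (hμ : 0 < μ) (hm : 0 < m) {s a ρ : ℝ} (hs : 0 ≤ s)
    (ha : a = μ * (1 + κ) / gbar) (hρ : ρ = a / (a + s)) :
    mgf γ P (-s) = ρ ^ μ * (m / (m + μ * κ * (1 - ρ))) ^ m := by
  have ha0 : 0 < a := by rw [ha]; positivity
  have hρ0 : 0 < ρ := by rw [hρ]; positivity
  have hρ1 : 0 ≤ 1 - ρ := by
    rw [hρ, sub_nonneg, div_le_one (by positivity)]
    linarith
  have h1 := h.integral_comp (f := fun x => Real.exp (-s * x))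
    (Measurable.aestronglyMeasurable (by fun_prop))
  simp only [Function.comp_def] at h1
  rw [mgf, h1, integral_eq_lintegral_of_nonneg_ae (ae_of_all _ fun _ => Real.exp_nonneg _)
    (Measurable.aestronglyMeasurable (by fun_prop))]
  simp_rw [neg_mul]
  rw [lintegral_exp_kappaMuShadowed hg hκ hμ hm hs ha hρ, ENNReal.toReal_ofReal (by positivity)]

/-- The arguments of the Lauricella function in the bit error probability, as real numbers. -/
def snrArg (gbar κ μ β : ℝ) : ℝ := -2 * μ * (1 + κ) / (gbar * β)

theorem one_sub_snrArg_mul_pos {gbar κ μ β u t : ℝ} (hg : 0 < gbar) (hκ : 0 ≤ κ) (hμ : 0 < μ)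
    (hβ : 0 < β) (hu : 0 ≤ u) (ht : 0 ≤ t) : 0 < 1 - snrArg gbar κ μ β * t * u := by
  have : 1 - snrArg gbar κ μ β * t * u = 1 + 2 * μ * (1 + κ) / (gbar * β) * t * u := by
    rw [snrArg]
    ring
  rw [this]
  positivity

theorem mgf_kappaMuShadowed_eq_mul {Ω : Type*} [MeasurableSpace Ω] {P : Measure Ω}
    {γ : Ω → ℝ} {gbar κ μ m : ℝ} (h : HasLaw γ (kappaMuShadowed gbar κ μ m) P)
    (hg : 0 < gbar) (hκ : 0 ≤ κ) (hμ : 0 < μ) (hm : 0 < m) {β u : ℝ} (hβ : 0 < β) (hu : 0 < u) :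
    mgf γ P (-(β / (2 * u))) =
      (μ ^ μ * m ^ m * (1 + κ) ^ μ / (μ * κ + m) ^ m * (1 / gbar) ^ μ) * (2 / β) ^ μ * u ^ μ *
        ((1 - snrArg gbar κ μ β * u) ^ (-(μ - m)) *
          (1 - snrArg gbar κ μ β * (m / (μ * κ + m)) * u) ^ (-m)) := by
  have hA : 0 < 1 - snrArg gbar κ μ β * u := by
    simpa using one_sub_snrArg_mul_pos hg hκ hμ hβ hu.le zero_le_one
  have hB := one_sub_snrArg_mul_pos (t := m / (μ * κ + m)) hg hκ hμ hβ hu.le (by positivity)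
  set A := 1 - snrArg gbar κ μ β * u with hAdef
  set B := 1 - snrArg gbar κ μ β * (m / (μ * κ + m)) * u with hBdef
  set a := μ * (1 + κ) / gbar with ha
  have hm' : 0 < μ * κ + m := by positivity
  have ha0 : 0 < a := by positivity
  have hA' : A = 1 + a * (2 / β * u) := by
    rw [hAdef, snrArg, ha]
    field_simp
    ring
  -- This linear relation between A and B turns m + μκ(1-ρ) into (μκ+m)B/A, so the Nakagami factor
  -- contributes A^m B^(-m).
  have hB' : (μ * κ + m) * B = m * A + μ * κ := by
    rw [hBdef, hAdef]
    field_simp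
    ring
  have hρ : a * (2 / β * u) / A = a / (a + β / (2 * u)) := by
    rw [hA']
    field_simp
    ring
  rw [mgf_neg_of_hasLaw_kappaMuShadowed h hg hκ hμ hm (by positivity) ha hρ]
  have h2 : m / (m + μ * κ * (1 - a * (2 / β * u) / A)) = m / (μ * κ + m) * A / B := by
    have h3 : m + μ * κ * (1 - a * (2 / β * u) / A) = (μ * κ + m) * B / A := by
      rw [hB', eq_div_iff hA.ne', add_mul, mul_assoc _ _ A, sub_mul, div_mul_cancel₀ _ hA.ne', hA']
      ring
    rw [h3]
    field_simp
  have h4 : a ^ μ = μ ^ μ * (1 + κ) ^ μ * (1 / gbar) ^ μ := by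
    rw [← Real.mul_rpow (by positivity) (by positivity),
      ← Real.mul_rpow (by positivity) (by positivity), ha]
    congr 1
    ring
  rw [h2, Real.div_rpow (by positivity) hA.le, Real.mul_rpow ha0.le (by positivity),
    Real.mul_rpow (by positivity) hu.le, Real.div_rpow (by positivity) hB.le,
    Real.mul_rpow (by positivity) hA.le, Real.div_rpow hm.le hm'.le, h4, neg_sub,
    Real.rpow_sub hA, Real.rpow_neg hB.le]
  field_simp

/-- The parameters `b` of the Lauricella function in the bit error probability. -/
abbrev snrParam {L : ℕ} (μ m : Fin L → ℝ) : Fin L ⊕ Fin L → ℂ :=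
  Sum.elim (fun k => ((μ k - m k : ℝ) : ℂ)) (fun k => ((m k : ℝ) : ℂ))

/-- The arguments of the Lauricella function in the bit error probability. -/
abbrev snrArgs {L : ℕ} (gbar κ μ m : Fin L → ℝ) (β : ℝ) : Fin L ⊕ Fin L → ℂ :=
  Sum.elim (fun k => ((snrArg (gbar k) (κ k) (μ k) β : ℝ) : ℂ))
    (fun k => ((snrArg (gbar k) (κ k) (μ k) β * (m k / (μ k * κ k + m k)) : ℝ) : ℂ))

theorem lauricellaEuler_snrArgs {L : ℕ} {gbar κ μ m : Fin L → ℝ} {β : ℝ} (a c : ℝ)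
    (hgbar : ∀ k, 0 < gbar k) (hκ : ∀ k, 0 ≤ κ k) (hμ : ∀ k, 0 < μ k) (hm : ∀ k, 0 < m k)
    (hβ : 0 < β) :
    lauricellaEuler a c (snrParam μ m) (snrArgs gbar κ μ m β) =
      ((∫ u, ∏ k, ((1 - snrArg (gbar k) (κ k) (μ k) β * u) ^ (-(μ k - m k)) *
        (1 - snrArg (gbar k) (κ k) (μ k) β * (m k / (μ k * κ k + m k)) * u) ^ (-m k))
          ∂betaMeasure a c : ℝ) : ℂ) := by
  rw [lauricellaEuler, ← integral_complex_ofReal]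
  refine integral_congr_ae ?_
  filter_upwards [ae_mem_Ioo_betaMeasure a c] with u hu
  rw [Fintype.prod_sum_type, ← Finset.prod_mul_distrib, Complex.ofReal_prod]
  refine Finset.prod_congr rfl fun k _ => ?_
  have hA : 0 < 1 - snrArg (gbar k) (κ k) (μ k) β * u := by
    simpa using one_sub_snrArg_mul_pos (hgbar k) (hκ k) (hμ k) hβ hu.1.le zero_le_one
  have hB := one_sub_snrArg_mul_pos (t := m k / (μ k * κ k + m k)) (hgbar k) (hκ k) (hμ k) hβ
    hu.1.le (div_nonneg (hm k).le (add_nonneg (mul_nonneg (hμ k).le (hκ k)) (hm k).le))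
  rw [Complex.ofReal_mul, Complex.ofReal_cpow hA.le, Complex.ofReal_cpow hB.le]
  simp

theorem integral_gaussianQ_sqrt_sum_kappaMuShadowed
    {Ω : Type*} [MeasurableSpace Ω] {P : Measure Ω} [IsProbabilityMeasure P]
    {L : ℕ} {gbar κ μ m : Fin L → ℝ} {β : ℝ}
    (hgbar : ∀ k, 0 < gbar k) (hκ : ∀ k, 0 ≤ κ k) (hμ : ∀ k, 0 < μ k) (hm : ∀ k, 0 < m k)
    (hβ : 0 < β) {γ : Fin L → Ω → ℝ}
    (hlaw : ∀ k, HasLaw (γ k) (kappaMuShadowed (gbar k) (κ k) (μ k) (m k)) P)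
    (hindep : iIndepFun γ P) :
    ((∫ ω, gaussianQ (Real.sqrt (β * ∑ k, γ k ω)) ∂P : ℝ) : ℂ) =
      ((Real.Gamma (1 / 2 + ∑ k, μ k) / Real.Gamma (1 + ∑ k, μ k) *
        ∏ k, μ k ^ μ k * m k ^ m k * (1 + κ k) ^ μ k / (μ k * κ k + m k) ^ m k *
          (1 / gbar k) ^ μ k : ℝ) : ℂ) *
      ((Real.sqrt β / Real.sqrt (8 * Real.pi) * (2 / β) ^ (1 / 2 + ∑ k, μ k) : ℝ) : ℂ) *
      lauricellaEuler (1 / 2 + ∑ k, μ k) (1 / 2) (snrParam μ m) (snrArgs gbar κ μ m β) := by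
  set M := ∑ k, μ k with hM
  have hM0 : 0 ≤ M := Finset.sum_nonneg fun k _ => (hμ k).le
  set D := ∏ k, μ k ^ μ k * m k ^ m k * (1 + κ k) ^ μ k / (μ k * κ k + m k) ^ m k *
    (1 / gbar k) ^ μ k with hD
  have hnn : ∀ᵐ ω ∂P, 0 ≤ (∑ k, γ k) ω := by
    filter_upwards [ae_all_iff.2 fun k => ae_nonneg_of_hasLaw_kappaMuShadowed (hlaw k)] with ω hω
    simpa using Finset.sum_nonneg fun k _ => hω k
  have hmeas (k) : AEMeasurable (γ k) P := (hlaw k).aemeasurable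
  have h1 := integral_gaussianQ_sqrt_mul (Finset.aemeasurable_sum _ fun k _ => hmeas k) hnn hβ
  have hprod : ∀ᵐ u ∂betaMeasure (1 / 2) (1 / 2), mgf (∑ k, γ k) P (-(β / (2 * u))) =
      D * (2 / β) ^ M * u ^ M • ∏ k, ((1 - snrArg (gbar k) (κ k) (μ k) β * u) ^ (-(μ k - m k)) *
        (1 - snrArg (gbar k) (κ k) (μ k) β * (m k / (μ k * κ k + m k)) * u) ^ (-m k)) := by
    filter_upwards [ae_mem_Ioo_betaMeasure (1 / 2) (1 / 2)] with u hu
    rw [hindep.mgf_sum₀ hmeas, Finset.prod_congr rfl fun k _ =>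
      mgf_kappaMuShadowed_eq_mul (hlaw k) (hgbar k) (hκ k) (hμ k) (hm k) hβ hu.1,
      Finset.prod_mul_distrib, Finset.prod_mul_distrib, Finset.prod_mul_distrib, ← hD, hM,
      ← Real.rpow_sum_of_pos hu.1, ← Real.rpow_sum_of_pos (by positivity : 0 < 2 / β), smul_eq_mul,
      mul_assoc]
  simp only [Finset.sum_apply] at h1
  rw [h1, integral_congr_ae hprod, integral_const_mul,
    integral_rpow_smul_betaMeasure (by norm_num) (by norm_num) hM0,
    lauricellaEuler_snrArgs _ _ hgbar hκ hμ hm hβ, beta_half_half, beta,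
    show (1 : ℝ) / 2 + M + 1 / 2 = 1 + M by ring, Real.Gamma_one_half_eq]
  rw [← Complex.ofReal_mul, ← Complex.ofReal_mul]
  congr 1
  rw [smul_eq_mul, ← mul_assoc, ← mul_assoc]
  congr 1
  -- Both constants reduce to (2/β)^M/(2√π) times the Gamma quotient: one from B(1/2+M, 1/2)/(2π),
  -- the other from √β/√(8π)·(2/β)^(1/2).
  have h8 : Real.sqrt (8 * Real.pi) = 2 * Real.sqrt 2 * Real.sqrt Real.pi := by
    rw [show 8 * Real.pi = 2 ^ 2 * 2 * Real.pi by ring, Real.sqrt_mul (by norm_num),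
      Real.sqrt_mul (by norm_num), Real.sqrt_sq (by norm_num)]
  have hpi := Real.pi_pos
  have hG := Real.Gamma_pos_of_pos (show 0 < 1 + M by positivity)
  have hpi2 := Real.sq_sqrt hpi.le
  rw [h8, Real.rpow_add (by positivity), ← Real.sqrt_eq_rpow, Real.sqrt_div two_pos.le]
  field_simp
  rw [hpi2]

end

/-! ### The bit error probability -/

theorem mainTheorem8
    {Ω : Type*} [MeasurableSpace Ω] (P : Measure Ω) [IsProbabilityMeasure P]
    (L R : ℕ) (gbar κ μ m : Fin L → ℝ) (α β : Fin R → ℝ)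
    (hgbar : ∀ k, 0 < gbar k) (hκ : ∀ k, 0 ≤ κ k) (hμ : ∀ k, 0 < μ k) (hm : ∀ k, 0 < m k)
    (hβ : ∀ r, 0 < β r)
    (γ : Fin L → Ω → ℝ)
    (hlaw : ∀ k, HasLaw (γ k) (kappaMuShadowed (gbar k) (κ k) (μ k) (m k)) P)
    (hindep : iIndepFun γ P) :
    IsLauricellaFD (((1 / 2 + ∑ k, μ k : ℝ)) : ℂ)
      (Sum.elim (fun k => ((μ k - m k : ℝ) : ℂ)) (fun k => ((m k : ℝ) : ℂ)))
      ((1 + ∑ k, μ k : ℝ) : ℂ)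
      (lauricellaFD (((1 / 2 + ∑ k, μ k : ℝ)) : ℂ)
        (Sum.elim (fun k => ((μ k - m k : ℝ) : ℂ)) (fun k => ((m k : ℝ) : ℂ)))
        ((1 + ∑ k, μ k : ℝ) : ℂ)) ∧
    ((∑ r, α r * ∫ ω, gaussianQ (Real.sqrt (β r * ∑ k, γ k ω)) ∂P : ℝ) : ℂ) =
      ((Real.Gamma (1 / 2 + ∑ k, μ k) / Real.Gamma (1 + ∑ k, μ k) *
        ∏ k, μ k ^ μ k * m k ^ m k * (1 + κ k) ^ μ k / (μ k * κ k + m k) ^ m k *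
          (1 / gbar k) ^ μ k : ℝ) : ℂ) *
      ∑ r, ((α r * Real.sqrt (β r) / Real.sqrt (8 * Real.pi) *
          (2 / β r) ^ (1 / 2 + ∑ k, μ k) : ℝ) : ℂ) *
        lauricellaFD (((1 / 2 + ∑ k, μ k : ℝ)) : ℂ)
          (Sum.elim (fun k => ((μ k - m k : ℝ) : ℂ)) (fun k => ((m k : ℝ) : ℂ)))
          ((1 + ∑ k, μ k : ℝ) : ℂ)
          (Sum.elim
            (fun k => ((-2 * μ k * (1 + κ k) / (gbar k * β r) : ℝ) : ℂ))
            (fun k => ((-2 * μ k * (1 + κ k) / (gbar k * β r) *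
              (m k / (μ k * κ k + m k)) : ℝ) : ℂ))) := by
  -- Only nonnegativity: M = 0 when L = 0.
  have hM0 : 0 ≤ ∑ k, μ k := Finset.sum_nonneg fun k _ => (hμ k).le
  have hE := isLauricellaFD_lauricellaEuler (show 0 < 1 / 2 + ∑ k, μ k by positivity)
    (show (0 : ℝ) < 1 / 2 by norm_num) (snrParam μ m)
  rw [show 1 / 2 + ∑ k, μ k + 1 / 2 = 1 + ∑ k, μ k by ring] at hE
  have hF : IsLauricellaFD (((1 / 2 + ∑ k, μ k : ℝ)) : ℂ) (snrParam μ m)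
      ((1 + ∑ k, μ k : ℝ) : ℂ)
      (lauricellaFD (((1 / 2 + ∑ k, μ k : ℝ)) : ℂ) (snrParam μ m) ((1 + ∑ k, μ k : ℝ) : ℂ)) :=
    -- Euler's integral is the witness that makes the chosen function a genuine continuation.
    Classical.epsilon_spec ⟨_, hE⟩
  refine ⟨hF, ?_⟩
  rw [Complex.ofReal_sum, Finset.mul_sum]
  refine Finset.sum_congr rfl fun r _ => ?_
  -- The arguments are negative reals, possibly of modulus at least 1, so they avoid the cut but
  -- need not lie in the polydisc.
  have hdom : snrArgs gbar κ μ m (β r) ∈ lauricellaFDDomain (Fin L ⊕ Fin L) := by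
    have hpos (k) {t : ℝ} (ht : 0 ≤ t) := one_sub_snrArg_mul_pos (u := 1) (hgbar k) (hκ k) (hμ k)
      (hβ r) zero_le_one ht
    rintro (k | k)
    · have := hpos k zero_le_one
      rw [mul_one, mul_one] at this
      rw [snrArgs, Sum.elim_inl, ← Complex.ofReal_one, ← Complex.ofReal_sub]
      exact Complex.ofReal_mem_slitPlane.2 this
    · have := hpos k
        (div_nonneg (hm k).le (add_nonneg (mul_nonneg (hμ k).le (hκ k)) (hm k).le))
      rw [mul_one] at this
      rw [snrArgs, Sum.elim_inr, ← Complex.ofReal_one, ← Complex.ofReal_sub]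
      exact Complex.ofReal_mem_slitPlane.2 this
  have hval := hF.eqOn hE hdom
  simp only [snrArgs, snrArg] at hval
  rw [hval, Complex.ofReal_mul,
    integral_gaussianQ_sqrt_sum_kappaMuShadowed hgbar hκ hμ hm (hβ r) hlaw hindep]
  simp only [snrArgs, snrArg]
  push_cast
  ring
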